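/- Let $N\ge 0$ be an integer and let $[\![N]\!]=\{0,1,\dots,N\}$ be a set of parties, where $0$ is called the purifier. An entropy vector is a family $S=(S_X)$ of real numbers indexed by the non-empty subsets $X\subseteq\{1,\dots,N\}$. Extend it to all subsets of $[\![N]\!]$ by $S_\varnothing=S_{[\![N]\!]}=0$ and $S_X=S_{[\![N]\!]\setminus X}$ whenever $0\in X\neq[\![N]\!]$, and for disjoint non-empty $X,Y\subseteq[\![N]\!]$ put $I(X:Y)=S_X+S_Y-S_{X\cup Y}$. The vector $S$ satisfies subadditivity (SA) if $I(X:Y)\ge 0$ for all disjoint non-empty $X,Y\subseteq[\![N]\!]$, and strong subadditivity (SSA) if $I(X:Y\cup Z)\ge I(X:Y)$ for all pairwise disjoint non-empty $X,Y,Z\subseteq[\![N]\!]$. The correlation hypergraph of $S$ has vertex set $[\![N]\!]$, and its hyperedges are the sets $X\subseteq[\![N]\!]$ with $|X|\ge 2$ such that $I(Y:Z)\neq 0$ for every partition $X=Y\sqcup Z$ into two non-empty sets. Its line graph has the hyperedges as vertices, two distinct hyperedges being adjacent if and only if they intersect. A graph is chordal if every cycle of length at least four has a chord. A holographic graph model is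 a finite graph $(V,E)$ with edge weights $w(e)\ge 0$, a set $\partial V\subseteq V$ of boundary vertices, and a labeling of each boundary vertex by one party such that every party labels at least one boundary vertex. It is a simple forest if distinct boundary vertices have distinct labels and the graph has no cycles (it need not be connected). For $X\subseteq[\![N]\!]$, an $X$-cut is a set $C\subseteq V$ such that the boundary vertices in $C$ are exactly the boundary vertices labeled by parties in $X$; its cost is the sum of the weights of the edges with exactly one endpoint in $C$. The model realizes $S$ if, for every non-empty $X\subseteq\{1,\dots,N\}$, the minimum cost of an $X$-cut equals $S_X$. **Theorem.** Let $S$ be an entropy vector that satisfies SA and SSA. Then $S$ is realized by some holographic graph model that is a simple forest if and only if the line graph of the correlation hypergraph of $S$ is chordal. -/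

import Mathlib

/-- The parties `0, 1, …, N`; the party `0` is the purifier. -/
abbrev Party (N : ℕ) : Type := Fin (N + 1)

/-- The non-empty subsets of `{1, …, N}`, which index the components of an entropy vector. -/
abbrev EntropyIndex (N : ℕ) : Type :=
  {X : Finset (Party N) // X.Nonempty ∧ (0 : Party N) ∉ X}

/-- Entropy space, of dimension `2 ^ N - 1`. -/
abbrev EntropyVector (N : ℕ) : Type := EntropyIndex N → ℝ

namespace EntropyVector

open Classical in
/-- The entropy of an arbitrary subset of `{0, …, N}`: a subset that contains the purifier is replaced
by its complement, and the empty set has entropy `0` (hence so has the set of all parties). -/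
noncomputable def ent {N : ℕ} (S : EntropyVector N) (X : Finset (Party N)) : ℝ :=
  if h : X.Nonempty ∧ (0 : Party N) ∉ X then S ⟨X, h⟩
  else if h : Xᶜ.Nonempty ∧ (0 : Party N) ∉ Xᶜ then S ⟨Xᶜ, h⟩
  else 0

/-- The mutual information `I(X : Y) = S_X + S_Y - S_{XY}`. -/
noncomputable def mutualInfo {N : ℕ} (S : EntropyVector N) (X Y : Finset (Party N)) : ℝ :=
  S.ent X + S.ent Y - S.ent (X ∪ Y)

end EntropyVector

/-- An instance `I(X : Y)` of the mutual information: a pair of disjoint non-empty sets of parties.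
The instances `I(X : Y)` and `I(Y : X)` have the same value for every entropy vector. -/
structure MIInstance (N : ℕ) where
  fst : Finset (Party N)
  snd : Finset (Party N)
  fst_nonempty : fst.Nonempty
  snd_nonempty : snd.Nonempty
  disjoint : Disjoint fst snd

namespace EntropyVector

/-- All instances of subadditivity (including those that involve the purifier). -/
def SA {N : ℕ} (S : EntropyVector N) : Prop :=
  ∀ I : MIInstance N, 0 ≤ S.mutualInfo I.fst I.snd

/-- All instances of strong subadditivity (including those that involve the purifier). -/
def SSA {N : ℕ} (S : EntropyVector N) : Prop :=
  ∀ X Y Z : Finset (Party N), X.Nonempty → Y.Nonempty → Z.Nonempty →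
    Disjoint X Y → Disjoint X Z → Disjoint Y Z →
    S.mutualInfo X Y ≤ S.mutualInfo X (Y ∪ Z)

/-- The pattern of marginal independence: the set of vanishing instances of the mutual information. -/
def pmi {N : ℕ} (S : EntropyVector N) : Set (MIInstance N) :=
  {I | S.mutualInfo I.fst I.snd = 0}

end EntropyVector

/-- The `β`-set of `X`: the instances of the mutual information whose arguments form a bipartition
of `X`. -/
def betaSet {N : ℕ} (X : Finset (Party N)) : Set (MIInstance N) :=
  {I | I.fst ∪ I.snd = X}

/-- The `β`-set of `X` is positive, with respect to the set `D` of vanishing instances, if none of its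
elements belongs to `D`. -/
def BetaPositive {N : ℕ} (D : Set (MIInstance N)) (X : Finset (Party N)) : Prop :=
  betaSet X ⊆ Dᶜ

/-- The correlation hypergraph: its vertices are all the parties, its hyperedges are the sets of at
least two parties whose `β`-set is positive. -/
def correlationHypergraph {N : ℕ} (D : Set (MIInstance N)) : Hypergraph (Party N) where
  vertexSet := Set.univ
  edgeSet := {e | ∃ X : Finset (Party N), 2 ≤ X.card ∧ BetaPositive D X ∧ (X : Set (Party N)) = e}
  subset_vertexSet_of_mem_edgeSet' := fun _ _ => Set.subset_univ _

/-- The line graph of a hypergraph: the intersection graph of its set of hyperedges. -/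
def hypergraphLineGraph {α : Type*} (H : Hypergraph α) : SimpleGraph H.edgeSet where
  Adj e f := e ≠ f ∧ ((e : Set α) ∩ (f : Set α)).Nonempty
  symm := ⟨fun _ _ h => ⟨h.1.symm, by rw [Set.inter_comm]; exact h.2⟩⟩
  loopless := ⟨fun _ h => h.1 rfl⟩

/-- A graph is chordal if every cycle of length at least four has a chord, that is, an edge of the graph
that joins two vertices of the cycle and is not an edge of the cycle. -/
def IsChordalGraph {V : Type*} (G : SimpleGraph V) : Prop :=
  ∀ (v : V) (c : G.Walk v v), c.IsCycle → 4 ≤ c.length →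
    ∃ a ∈ c.support, ∃ b ∈ c.support, G.Adj a b ∧ s(a, b) ∉ c.edges

/-- An `N`-party holographic graph model on a vertex set `V`: a graph with non-negative edge
weights, and a set of boundary vertices labeled by the parties, in which each party labels at least one
boundary vertex. -/
structure HolographicGraphModel (N : ℕ) (V : Type*) where
  graph : SimpleGraph V
  weight : Sym2 V → ℝ
  weight_nonneg : ∀ e ∈ graph.edgeSet, 0 ≤ weight e
  boundary : Set V
  label : boundary → Party N
  label_surjective : Function.Surjective label

namespace HolographicGraphModel

/-- Distinct boundary vertices are labeled by distinct parties. -/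
def IsSimple {N : ℕ} {V : Type*} (M : HolographicGraphModel N V) : Prop :=
  Function.Injective M.label

/-- A simple forest: a simple model whose graph has no cycles (it need not be connected). -/
def IsSimpleForest {N : ℕ} {V : Type*} (M : HolographicGraphModel N V) : Prop :=
  M.IsSimple ∧ M.graph.IsAcyclic

/-- `C` is an `X`-cut: the boundary vertices in `C` are exactly those labeled by parties in `X`. -/
def IsCut {N : ℕ} {V : Type*} (M : HolographicGraphModel N V) (X : Finset (Party N))
    (C : Finset V) : Prop :=
  ∀ b : M.boundary, (b : V) ∈ C ↔ M.label b ∈ X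

open Classical in
/-- The edges with one endpoint in `C` and the other one outside `C`. -/
noncomputable def cutEdges {N : ℕ} {V : Type*} [Fintype V] (M : HolographicGraphModel N V)
    (C : Finset V) : Finset (Sym2 V) :=
  {e | e ∈ M.graph.edgeSet ∧ ∃ v ∈ C, ∃ v' ∉ C, e = s(v, v')}

/-- The cost of a cut: the sum of the weights of its cut edges. -/
noncomputable def cost {N : ℕ} {V : Type*} [Fintype V] (M : HolographicGraphModel N V)
    (C : Finset V) : ℝ :=
  ∑ e ∈ M.cutEdges C, M.weight e

/-- `s` is the entropy of `X` in the model: the minimum of the costs of all `X`-cuts. -/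
def IsEntropy {N : ℕ} {V : Type*} [Fintype V] (M : HolographicGraphModel N V)
    (X : Finset (Party N)) (s : ℝ) : Prop :=
  IsLeast {r | ∃ C : Finset V, M.IsCut X C ∧ r = M.cost C} s

/-- `S` is the entropy vector of the model. -/
def Realizes {N : ℕ} {V : Type*} [Fintype V] (M : HolographicGraphModel N V)
    (S : EntropyVector N) : Prop :=
  ∀ X : EntropyIndex N, M.IsEntropy (X : Finset (Party N)) (S X)

end HolographicGraphModel

/-! Under SA and SSA the extended entropy `f = S.ent` is a symmetric submodular function, and the
hyperedges are its connected sets with at least two elements. Both sides of the equivalence are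
compared with `IsCrossFree`, which forbids a cyclic pattern of four connected sets: consecutive ones
meet, opposite ones are disjoint.

Such a pattern is a chordless 4-cycle of the line graph. Conversely, in a longer chordless cycle all
vertices but three consecutive ones can be merged, because intersecting connected sets have a
connected union (`IsSymmSubmodular.isConnectedSet_union`). So chordality of the line graph amounts
to cross-freeness.

In a forest model, disjoint sets of parties have disjoint minimum cuts, and the parties of a
connected set are joined by walks inside its minimum cut. A forbidden pattern would therefore yield
four walks closing up into a cycle (`SimpleGraph.IsAcyclic.false_of_disjoint_walks`).

Conversely, split the parties into components, the minimal sets of value zero. Among the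
bipartitions of a component into two connected sets, keep the half that avoids a chosen root;
cross-freeness makes these halves laminar, hence the vertices of a tree in which the edge above `X`
has weight `f X`. No cut is too cheap because the edges it uses cover the parties, or the
complementary parties, an odd number of times (`IsPartyHierarchy.le_model_cost`). Cheap enough cuts
exist by a minimal counterexample argument (`IsPartyHierarchy.exists_cut`). -/

/-! ### Symmetric submodular functions and their connected sets. -/

/-- A set function that is symmetric under complementation, submodular, and zero on the empty set. -/
structure IsSymmSubmodular {α : Type*} [Fintype α] [DecidableEq α] (f : Finset α → ℝ) : Prop where
  empty : f ∅ = 0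
  compl : ∀ X, f Xᶜ = f X
  submod : ∀ X Y, f (X ∪ Y) + f (X ∩ Y) ≤ f X + f Y

/-- A non-empty set is connected if no bipartition of it into non-empty sets is additive. -/
def IsConnectedSet {α : Type*} [DecidableEq α] (f : Finset α → ℝ) (X : Finset α) : Prop :=
  X.Nonempty ∧ ∀ Y Z : Finset α, Y.Nonempty → Z.Nonempty → Disjoint Y Z → Y ∪ Z = X →
    f Y + f Z ≠ f X

namespace IsSymmSubmodular

variable {α : Type*} [Fintype α] [DecidableEq α] {f : Finset α → ℝ}

theorem univ (hf : IsSymmSubmodular f) : f Finset.univ = 0 := by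
  rw [← hf.empty, ← hf.compl ∅, Finset.compl_empty]

theorem nonneg (hf : IsSymmSubmodular f) (X : Finset α) : 0 ≤ f X := by
  have h := hf.submod X Xᶜ
  rw [Finset.union_compl, Finset.inter_compl, hf.univ, hf.empty, hf.compl] at h
  linarith

theorem union_le (hf : IsSymmSubmodular f) (X Y : Finset α) : f (X ∪ Y) ≤ f X + f Y := by
  linarith [hf.submod X Y, hf.nonneg (X ∩ Y)]

theorem posimodular (hf : IsSymmSubmodular f) (X Y : Finset α) :
    f (X \ Y) + f (Y \ X) ≤ f X + f Y := by
  have h := hf.submod X Yᶜ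
  have h1 : X ∪ Yᶜ = (Y \ X)ᶜ := by ext; simp; tauto
  have h2 : X ∩ Yᶜ = X \ Y := by ext; simp
  rw [h1, h2, hf.compl, hf.compl] at h
  linarith

theorem symmDiff_le (hf : IsSymmSubmodular f) (X Y : Finset α) :
    f (symmDiff X Y) ≤ f X + f Y :=
  (hf.union_le _ _).trans (hf.posimodular X Y)

/-- Additivity is inherited by subsets: submodularity for `X, Y` and then for `X ∪ Y, Z` bounds the
sum above, and subadditivity bounds it below. -/
theorem additive_inter (hf : IsSymmSubmodular f) {X Y Z : Finset α} (hYZ : Disjoint Y Z)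
    (h : f Y + f Z = f (Y ∪ Z)) (hX : X ⊆ Y ∪ Z) : f (X ∩ Y) + f (X ∩ Z) = f X := by
  apply le_antisymm
  · have h1 := hf.submod X Y
    have h2 := hf.submod (X ∪ Y) Z
    have e1 : X ∪ Y ∪ Z = Y ∪ Z := by
      rw [Finset.union_assoc, Finset.union_eq_right.2 hX]
    have e2 : (X ∪ Y) ∩ Z = X ∩ Z := by
      rw [Finset.union_inter_distrib_right, Finset.disjoint_iff_inter_eq_empty.1 hYZ,
        Finset.union_empty]
    rw [e1, e2] at h2
    linarith
  · have h1 := hf.union_le (X ∩ Y) (X ∩ Z)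
    rwa [← Finset.inter_union_distrib_left, Finset.inter_eq_left.2 hX] at h1

/-- A connected subset of an additive union lies in one of the two parts. -/
theorem subset_or_subset (hf : IsSymmSubmodular f) {X Y Z : Finset α} (hc : IsConnectedSet f X)
    (hYZ : Disjoint Y Z) (h : f Y + f Z = f (Y ∪ Z)) (hX : X ⊆ Y ∪ Z) : X ⊆ Y ∨ X ⊆ Z := by
  by_contra! hcon
  obtain ⟨h1, h2⟩ := hcon
  obtain ⟨a, haX, haY⟩ := Finset.not_subset.1 h1
  obtain ⟨b, hbX, hbZ⟩ := Finset.not_subset.1 h2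
  have haZ : a ∈ Z := (Finset.mem_union.1 (hX haX)).resolve_left haY
  have hbY : b ∈ Y := (Finset.mem_union.1 (hX hbX)).resolve_right hbZ
  refine hc.2 (X ∩ Y) (X ∩ Z) ⟨b, by simp [*]⟩ ⟨a, by simp [*]⟩
    (hYZ.mono Finset.inter_subset_right Finset.inter_subset_right) ?_
    (hf.additive_inter hYZ h hX)
  rw [← Finset.inter_union_distrib_left, Finset.inter_eq_left.2 hX]

/-- An additive bipartition of the union would contain each of the two sets in one part; the common
point makes it the same part, so the other one is empty. -/
theorem isConnectedSet_union (hf : IsSymmSubmodular f) {X Y : Finset α}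
    (hX : IsConnectedSet f X) (hY : IsConnectedSet f Y) (hXY : (X ∩ Y).Nonempty) :
    IsConnectedSet f (X ∪ Y) := by
  refine ⟨hX.1.mono Finset.subset_union_left, fun A B hA hB hAB hU h => ?_⟩
  rw [← hU] at h
  obtain ⟨a, ha⟩ := hXY
  obtain ⟨haX, haY⟩ := Finset.mem_inter.1 ha
  have key : ∀ A B : Finset α, Disjoint A B → A ∪ B = X ∪ Y → B.Nonempty →
      X ⊆ A → Y ⊆ A → False := by
    intro A B hAB hU ⟨b, hb⟩ h1 h2
    have : b ∈ A := by
      have : b ∈ X ∪ Y := hU ▸ Finset.mem_union_right _ hb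
      exact (Finset.union_subset h1 h2) this
    exact Finset.disjoint_left.1 hAB this hb
  rcases hf.subset_or_subset hX hAB h (hU ▸ Finset.subset_union_left) with h1 | h1 <;>
    rcases hf.subset_or_subset hY hAB h (hU ▸ Finset.subset_union_right) with h2 | h2
  · exact key A B hAB hU hB h1 h2
  · exact Finset.disjoint_left.1 hAB (h1 haX) (h2 haY)
  · exact Finset.disjoint_left.1 hAB (h2 haY) (h1 haX)
  · exact key B A hAB.symm (by rw [Finset.union_comm, hU]) hA h1 h2

/-- A set of value zero and its complement form an additive bipartition of the whole, which no
connected set can straddle. -/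
theorem subset_of_eq_zero (hf : IsSymmSubmodular f) {X W : Finset α} (hX : IsConnectedSet f X)
    (hW : f W = 0) (hXW : (X ∩ W).Nonempty) : X ⊆ W := by
  rcases hf.subset_or_subset (Y := W) (Z := Wᶜ) hX disjoint_compl_right
    (by rw [hf.compl, Finset.union_compl, hf.univ, hW, add_zero]) (by simp) with h | h
  · exact h
  · obtain ⟨a, ha⟩ := hXW
    have := h (Finset.mem_inter.1 ha).1
    simp [(Finset.mem_inter.1 ha).2] at this

/-- Take a smallest zero set through a point of `X`. Values being non-negative, an additive
bipartition of it would consist of zero sets, one of them smaller and through the same point. -/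
theorem exists_component (hf : IsSymmSubmodular f) {X : Finset α} (hX : IsConnectedSet f X) :
    ∃ K, f K = 0 ∧ IsConnectedSet f K ∧ X ⊆ K := by
  obtain ⟨p, hp⟩ := hX.1
  obtain ⟨K, hK, hmin⟩ := (Finset.univ.filter fun K : Finset α => f K = 0 ∧ p ∈ K).exists_min_image
    Finset.card ⟨Finset.univ, by simp [hf.univ]⟩
  simp only [Finset.mem_filter, Finset.mem_univ, true_and, and_imp] at hK hmin
  refine ⟨K, hK.1, ⟨⟨p, hK.2⟩, fun Y Z hY hZ hYZ hU h => ?_⟩,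
    hf.subset_of_eq_zero hX hK.1 ⟨p, by simp [hp, hK.2]⟩⟩
  have hcard : Y.card + Z.card = K.card := by rw [← hU, Finset.card_union_of_disjoint hYZ]
  have hY0 := hf.nonneg Y
  have hZ0 := hf.nonneg Z
  have := hY.card_pos
  have := hZ.card_pos
  rw [hK.1] at h
  rcases Finset.mem_union.1 (hU ▸ hK.2) with hp' | hp'
  · have := hmin Y (by linarith) hp'
    omega
  · have := hmin Z (by linarith) hp'
    omega

theorem sdiff_eq (hf : IsSymmSubmodular f) {X K : Finset α} (hK : f K = 0) (hX : X ⊆ K) :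
    f (K \ X) = f X := by
  have key : ∀ X, X ⊆ K → f (K \ X) ≤ f X := fun X hX => by
    have h := hf.posimodular K X
    rw [Finset.sdiff_eq_empty_iff_subset.2 hX, hf.empty, hK] at h
    linarith
  apply le_antisymm (key X hX)
  simpa [Finset.inter_eq_right.2 hX] using key (K \ X) Finset.sdiff_subset

/-- The value of the set of points covered an odd number of times is at most the sum over the family. -/
theorem odd_cover_le (hf : IsSymmSubmodular f) (T : Finset (Finset α)) :
    f (Finset.univ.filter fun i => Odd (T.filter fun Y => i ∈ Y).card) ≤ ∑ Y ∈ T, f Y := by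
  induction T using Finset.induction_on with
  | empty => simp [hf.empty]
  | insert A T hA ih =>
    rw [Finset.sum_insert hA]
    have : (Finset.univ.filter fun i => Odd ((insert A T).filter fun Y => i ∈ Y).card) =
        symmDiff A (Finset.univ.filter fun i => Odd (T.filter fun Y => i ∈ Y).card) := by
      ext i
      by_cases hi : i ∈ A
      · have hA' : A ∉ T.filter fun Y => i ∈ Y := by simp [hA]
        simp [Finset.mem_symmDiff, Finset.filter_insert, hi, Finset.card_insert_of_notMem hA',
          Nat.odd_add_one]
      · simp [Finset.mem_symmDiff, Finset.filter_insert, hi]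
    rw [this]
    linarith [hf.symmDiff_le A (Finset.univ.filter fun i => Odd (T.filter fun Y => i ∈ Y).card)]

end IsSymmSubmodular

/-! ### Entropy as a symmetric submodular function. -/

namespace EntropyVector

variable {N : ℕ} {S : EntropyVector N}

theorem ent_empty : S.ent ∅ = 0 := by
  simp [ent]

theorem ent_compl (X : Finset (Party N)) : S.ent Xᶜ = S.ent X := by
  by_cases h : (0 : Party N) ∈ X <;> by_cases hX : X.Nonempty <;> by_cases hX' : Xᶜ.Nonempty <;>
    simp_all [ent]

theorem isSymmSubmodular (hSA : S.SA) (hSSA : S.SSA) : IsSymmSubmodular S.ent where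
  empty := ent_empty
  compl := ent_compl
  submod X Y := by
    rcases (X ∩ Y).eq_empty_or_nonempty with h0 | h0
    · rw [h0, ent_empty]
      rcases X.eq_empty_or_nonempty with rfl | hX
      · simp [ent_empty]
      rcases Y.eq_empty_or_nonempty with rfl | hY
      · simp [ent_empty]
      have := hSA ⟨X, Y, hX, hY, Finset.disjoint_iff_inter_eq_empty.2 h0⟩
      simp only [mutualInfo] at this
      linarith
    rcases (X \ Y).eq_empty_or_nonempty with h1 | h1
    · rw [Finset.sdiff_eq_empty_iff_subset] at h1
      rw [Finset.union_eq_right.2 h1, Finset.inter_eq_left.2 h1, add_comm]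
    rcases (Y \ X).eq_empty_or_nonempty with h2 | h2
    · rw [Finset.sdiff_eq_empty_iff_subset] at h2
      rw [Finset.union_eq_left.2 h2, Finset.inter_eq_right.2 h2]
    -- SSA is submodularity when these three pieces are non-empty; the degenerate cases above are SA
    -- or trivial.
    have := hSSA (X \ Y) (X ∩ Y) (Y \ X) h1 h0 h2
      (Finset.disjoint_left.2 (by simp; tauto)) (Finset.disjoint_left.2 (by simp; tauto))
      (Finset.disjoint_left.2 (by simp; tauto))
    simp only [mutualInfo] at this
    have e1 : X \ Y ∪ X ∩ Y = X := by ext; simp; tauto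
    have e2 : X ∩ Y ∪ Y \ X = Y := by ext; simp; tauto
    have e3 : X \ Y ∪ Y = X ∪ Y := by ext; simp
    rw [e1, e2, e3] at this
    linarith

/-- The hyperedges of the correlation hypergraph are the connected sets of at least two parties. -/
theorem mem_edgeSet_iff (e : Set (Party N)) :
    e ∈ (correlationHypergraph S.pmi).edgeSet ↔
      ∃ X : Finset (Party N), 2 ≤ X.card ∧ IsConnectedSet S.ent X ∧ (X : Set (Party N)) = e := by
  have key : ∀ X : Finset (Party N), 2 ≤ X.card →
      (BetaPositive S.pmi X ↔ IsConnectedSet S.ent X) := by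
    intro X hX
    constructor
    · refine fun h => ⟨Finset.card_pos.1 (by omega), fun Y Z hY hZ hYZ hU he => ?_⟩
      refine h (a := ⟨Y, Z, hY, hZ, hYZ⟩) hU ?_
      simp only [pmi, mutualInfo, Set.mem_ofPred_eq, hU]
      linarith
    · intro h I hI hD
      refine h.2 I.fst I.snd I.fst_nonempty I.snd_nonempty I.disjoint hI ?_
      simp only [betaSet, Set.mem_ofPred_eq] at hI
      simp only [pmi, mutualInfo, Set.mem_ofPred_eq, hI] at hD
      linarith
  change (∃ X : Finset (Party N), 2 ≤ X.card ∧ BetaPositive S.pmi X ∧ _) ↔ _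
  exact exists_congr fun X => and_congr_right fun hX => and_congr_left' (key X hX)

end EntropyVector

/-! ### From chordality to cross-freeness. -/

/-- No two pairs of disjoint connected sets meet in all four ways. -/
def IsCrossFree {α : Type*} [DecidableEq α] (f : Finset α → ℝ) : Prop :=
  ∀ A B C D : Finset α, IsConnectedSet f A → IsConnectedSet f B → IsConnectedSet f C →
    IsConnectedSet f D → Disjoint A C → Disjoint B D → (A ∩ B).Nonempty → (B ∩ C).Nonempty →
    (C ∩ D).Nonempty → (D ∩ A).Nonempty → False

theorem Finset.two_le_card_of_disjoint_inter {α : Type*} [DecidableEq α] {A B C : Finset α}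
    (h1 : (A ∩ B).Nonempty) (h2 : (A ∩ C).Nonempty) (h : Disjoint B C) : 2 ≤ A.card := by
  obtain ⟨x, hx⟩ := h1
  obtain ⟨y, hy⟩ := h2
  rw [Finset.mem_inter] at hx hy
  refine Finset.one_lt_card.2 ⟨x, hx.1, y, hy.1, ?_⟩
  rintro rfl
  exact Finset.disjoint_left.1 h hx.2 hy.2

theorem isCrossFree_of_isChordalGraph {N : ℕ} {S : EntropyVector N}
    (h : IsChordalGraph (hypergraphLineGraph (correlationHypergraph S.pmi))) :
    IsCrossFree S.ent := by
  intro A B C D hA hB hC hD hAC hBD hAB hBC hCD hDA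
  have hBA : (B ∩ A).Nonempty := by rwa [Finset.inter_comm]
  have hCB : (C ∩ B).Nonempty := by rwa [Finset.inter_comm]
  have hDC : (D ∩ C).Nonempty := by rwa [Finset.inter_comm]
  have hAD : (A ∩ D).Nonempty := by rwa [Finset.inter_comm]
  -- Each set meets two disjoint neighbours, so none is a singleton and all four are genuine
  -- hyperedges.
  have cA := Finset.two_le_card_of_disjoint_inter hAB hAD hBD
  have cB := Finset.two_le_card_of_disjoint_inter hBA hBC hAC
  have cC := Finset.two_le_card_of_disjoint_inter hCB hCD hBD
  have cD := Finset.two_le_card_of_disjoint_inter hDA hDC hAC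
  let G := hypergraphLineGraph (correlationHypergraph S.pmi)
  let V := (correlationHypergraph S.pmi).edgeSet
  let a : V := ⟨A, (EntropyVector.mem_edgeSet_iff _).2 ⟨A, cA, hA, rfl⟩⟩
  let b : V := ⟨B, (EntropyVector.mem_edgeSet_iff _).2 ⟨B, cB, hB, rfl⟩⟩
  let c : V := ⟨C, (EntropyVector.mem_edgeSet_iff _).2 ⟨C, cC, hC, rfl⟩⟩
  let d : V := ⟨D, (EntropyVector.mem_edgeSet_iff _).2 ⟨D, cD, hD, rfl⟩⟩
  have hne : ∀ {X Y Z : Finset (Party N)}, (X ∩ Z).Nonempty → Disjoint Y Z → X ≠ Y := by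
    rintro X Y Z h1 h2 rfl
    exact h1.ne_empty (Finset.disjoint_iff_inter_eq_empty.1 h2)
  have nab : a ≠ b := fun e => hne hAD hBD (Finset.coe_injective (congrArg Subtype.val e))
  have nbc : b ≠ c := fun e => hne hBA hAC.symm (Finset.coe_injective (congrArg Subtype.val e))
  have ncd : c ≠ d := fun e => hne hCB hBD.symm (Finset.coe_injective (congrArg Subtype.val e))
  have nda : d ≠ a := fun e => hne hDC hAC (Finset.coe_injective (congrArg Subtype.val e))
  have nac : a ≠ c := fun e => hA.1.ne_empty (by
    have := (Finset.coe_injective (congrArg Subtype.val e) : A = C)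
    subst this
    simpa using hAC)
  have nbd : b ≠ d := fun e => hB.1.ne_empty (by
    have := (Finset.coe_injective (congrArg Subtype.val e) : B = D)
    subst this
    simpa using hBD)
  have mk : ∀ {X Y : Finset (Party N)}, (X ∩ Y).Nonempty →
      ((X : Set (Party N)) ∩ (Y : Set (Party N))).Nonempty := by
    rintro X Y ⟨x, hx⟩
    exact ⟨x, by simpa using hx⟩
  have adjab : G.Adj a b := ⟨nab, mk hAB⟩
  have adjbc : G.Adj b c := ⟨nbc, mk hBC⟩
  have adjcd : G.Adj c d := ⟨ncd, mk hCD⟩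
  have adjda : G.Adj d a := ⟨nda, mk hDA⟩
  have nadjac : ¬ G.Adj a c := fun hadj => by
    obtain ⟨x, hx1, hx2⟩ := hadj.2
    exact Finset.disjoint_left.1 hAC hx1 hx2
  have nadjbd : ¬ G.Adj b d := fun hadj => by
    obtain ⟨x, hx1, hx2⟩ := hadj.2
    exact Finset.disjoint_left.1 hBD hx1 hx2
  let w : G.Walk a a := .cons adjab (.cons adjbc (.cons adjcd (.cons adjda .nil)))
  have hw : w.IsCycle := by
    rw [SimpleGraph.Walk.isCycle_def]
    refine ⟨?_, by simp [w], ?_⟩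
    · simp only [w, SimpleGraph.Walk.isTrail_def, SimpleGraph.Walk.edges_cons,
        SimpleGraph.Walk.edges_nil]
      simp [nab, nbc, ncd, nda, nac, nbd, nab.symm, nda.symm, nac.symm]
    · simp [w, nbc, ncd, nda, nbd, nab.symm, nac.symm]
  obtain ⟨x, hx, y, hy, hadj, hxy⟩ := h a w hw (by simp [w])
  simp only [w, SimpleGraph.Walk.support_cons, SimpleGraph.Walk.support_nil, List.mem_cons,
    List.not_mem_nil, or_false] at hx hy
  simp only [w, SimpleGraph.Walk.edges_cons, SimpleGraph.Walk.edges_nil, List.mem_cons,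
    List.not_mem_nil, or_false, Sym2.eq_iff] at hxy
  have hadj' : G.Adj x y := hadj
  have hs := hadj'.symm
  have hne := hadj'.ne
  rcases hx with rfl | rfl | rfl | rfl | rfl <;> rcases hy with rfl | rfl | rfl | rfl | rfl <;>
    simp_all

/-! ### Cuts and minimum cuts in graph models. -/

namespace HolographicGraphModel

variable {N : ℕ} {V : Type*} {M : HolographicGraphModel N V}

/-- The boundary vertex of a party. -/
noncomputable def boundaryVertex (M : HolographicGraphModel N V) (i : Party N) : V :=
  ((M.label_surjective i).choose : V)

theorem IsCut.boundaryVertex_mem {X : Finset (Party N)} {C : Finset V} (h : M.IsCut X C)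
    (i : Party N) : M.boundaryVertex i ∈ C ↔ i ∈ X := by
  have := h (M.label_surjective i).choose
  rwa [(M.label_surjective i).choose_spec] at this

theorem IsSimple.isCut_iff (hM : M.IsSimple) {X : Finset (Party N)} {C : Finset V} :
    M.IsCut X C ↔ ∀ i, M.boundaryVertex i ∈ C ↔ i ∈ X := by
  refine ⟨fun h => h.boundaryVertex_mem, fun h b => ?_⟩
  rw [← h (M.label b)]
  have : (M.label_surjective (M.label b)).choose = b :=
    hM (M.label_surjective (M.label b)).choose_spec
  rw [boundaryVertex, this]

variable [Fintype V] (M)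

theorem mem_cutEdges_iff {C : Finset V} {u v : V} :
    s(u, v) ∈ M.cutEdges C ↔ M.graph.Adj u v ∧ ¬ (u ∈ C ↔ v ∈ C) := by
  classical
  simp only [cutEdges, Finset.mem_filter, Finset.mem_univ, true_and, SimpleGraph.mem_edgeSet]
  refine and_congr_right fun _ => ⟨?_, fun h => ?_⟩
  · rintro ⟨x, hx, y, hy, he⟩
    rcases Sym2.eq_iff.1 he with ⟨rfl, rfl⟩ | ⟨rfl, rfl⟩ <;> tauto
  · by_cases hu : u ∈ C
    · exact ⟨u, hu, v, by tauto, rfl⟩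
    · exact ⟨v, by tauto, u, hu, Sym2.eq_swap⟩

theorem cutEdges_subset_edgeSet {C : Finset V} {e : Sym2 V} (he : e ∈ M.cutEdges C) :
    e ∈ M.graph.edgeSet := by
  classical
  simp only [cutEdges, Finset.mem_filter] at he
  exact he.2.1

open Classical in
theorem cost_eq_sum (C : Finset V) :
    M.cost C = ∑ e : Sym2 V, if e ∈ M.cutEdges C then M.weight e else 0 := by
  rw [cost, ← Finset.sum_filter]
  congr 1
  ext
  simp

theorem cost_nonneg (C : Finset V) : 0 ≤ M.cost C :=
  Finset.sum_nonneg fun _ he => M.weight_nonneg _ (M.cutEdges_subset_edgeSet he)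

theorem cost_union_le [DecidableEq V] (C D : Finset V) : M.cost (C ∪ D) ≤ M.cost C + M.cost D := by
  simp only [cost_eq_sum, ← Finset.sum_add_distrib]
  refine Finset.sum_le_sum fun e _ => ?_
  induction e with | _ u v
  by_cases hadj : M.graph.Adj u v
  · have hw := M.weight_nonneg s(u, v) hadj
    simp only [mem_cutEdges_iff, hadj, true_and, Finset.mem_union]
    by_cases h1 : u ∈ C <;> by_cases h2 : v ∈ C <;> by_cases h3 : u ∈ D <;> by_cases h4 : v ∈ D <;>
      simp [h1, h2, h3, h4, hw]
  · simp [mem_cutEdges_iff, hadj]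

theorem cost_sdiff_add_cost_sdiff_le [DecidableEq V] (C D : Finset V) :
    M.cost (C \ D) + M.cost (D \ C) ≤ M.cost C + M.cost D := by
  simp only [cost_eq_sum, ← Finset.sum_add_distrib]
  refine Finset.sum_le_sum fun e _ => ?_
  induction e with | _ u v
  by_cases hadj : M.graph.Adj u v
  · have hw := M.weight_nonneg s(u, v) hadj
    simp only [mem_cutEdges_iff, hadj, true_and, Finset.mem_sdiff]
    by_cases h1 : u ∈ C <;> by_cases h2 : v ∈ C <;> by_cases h3 : u ∈ D <;> by_cases h4 : v ∈ D <;>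
      simp [h1, h2, h3, h4, hw]
  · simp [mem_cutEdges_iff, hadj]

open Classical in
/-- A cut without edges between a part and the rest decomposes additively. -/
theorem cost_add_cost_sdiff_le {C D : Finset V} (hD : D ⊆ C)
    (h : ∀ u ∈ D, ∀ v ∈ C, M.graph.Adj u v → v ∈ D) :
    M.cost D + M.cost (C \ D) ≤ M.cost C := by
  simp only [cost_eq_sum, ← Finset.sum_add_distrib]
  refine Finset.sum_le_sum fun e _ => ?_
  induction e with | _ u v
  by_cases hadj : M.graph.Adj u v
  · have hw := M.weight_nonneg s(u, v) hadj
    simp only [mem_cutEdges_iff, hadj, true_and, Finset.mem_sdiff]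
    have a1 := @hD u
    have a2 := @hD v
    have a3 := h u
    have a4 := h v
    have hadj' := hadj.symm
    by_cases h1 : u ∈ C <;> by_cases h2 : v ∈ C <;> by_cases h3 : u ∈ D <;> by_cases h4 : v ∈ D <;>
      simp_all
  · simp [mem_cutEdges_iff, hadj]

theorem cost_empty : M.cost ∅ = 0 := by
  rw [cost, Finset.sum_eq_zero]
  intro e he
  induction e with | _ u v
  simp [mem_cutEdges_iff] at he

open Classical in
theorem cost_compl (C : Finset V) : M.cost Cᶜ = M.cost C := by
  rw [cost, cost]
  congr 1
  ext e
  induction e with | _ u v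
  simp only [mem_cutEdges_iff, Finset.mem_compl]
  tauto

variable {M}

open Classical in
theorem Realizes.isEntropy_ent {S : EntropyVector N} (h : M.Realizes S) (X : Finset (Party N)) :
    M.IsEntropy X (S.ent X) := by
  have hempty : M.IsEntropy ∅ 0 := by
    refine ⟨⟨∅, fun b => by simp, M.cost_empty.symm⟩, ?_⟩
    rintro _ ⟨C, -, rfl⟩
    exact M.cost_nonneg C
  have hcompl : ∀ X s, M.IsEntropy Xᶜ s → M.IsEntropy X s := by
    intro X s hs
    have : ∀ C : Finset V, M.IsCut X C ↔ M.IsCut Xᶜ Cᶜ := fun C => by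
      refine forall_congr' fun b => ?_
      rw [Finset.mem_compl, Finset.mem_compl, not_iff_not]
    constructor
    · obtain ⟨C, hC, e⟩ := hs.1
      exact ⟨Cᶜ, (this _).2 (by rwa [compl_compl]), e.trans (M.cost_compl C).symm⟩
    · rintro _ ⟨C, hC, rfl⟩
      rw [← M.cost_compl]
      exact hs.2 ⟨Cᶜ, (this C).1 hC, rfl⟩
  have hmain : ∀ X : Finset (Party N), 0 ∉ X → M.IsEntropy X (S.ent X) := by
    intro X hX
    rcases X.eq_empty_or_nonempty with rfl | hne
    · rwa [EntropyVector.ent_empty]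
    · have := h ⟨X, hne, hX⟩
      simpa [EntropyVector.ent, hne, hX] using this
  by_cases hX : (0 : Party N) ∈ X
  · rw [← EntropyVector.ent_compl]
    exact hcompl X _ (hmain _ (by simpa))
  · exact hmain X hX

theorem IsEntropy.le_cost {X : Finset (Party N)} {s : ℝ} (h : M.IsEntropy X s) {C : Finset V}
    (hC : M.IsCut X C) : s ≤ M.cost C :=
  h.2 ⟨C, hC, rfl⟩

open Classical in
/-- Inside a minimum cut of a connected set, all its boundary vertices are joined by walks. -/
theorem exists_walk_in_min_cut (hM : M.IsSimple) {f : Finset (Party N) → ℝ}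
    (hf : ∀ X, M.IsEntropy X (f X)) {X : Finset (Party N)} (hX : IsConnectedSet f X)
    {C : Finset V} (hC : M.IsCut X C) (hcost : M.cost C ≤ f X) {i j : Party N} (hi : i ∈ X)
    (hj : j ∈ X) :
    ∃ p : M.graph.Walk (M.boundaryVertex i) (M.boundaryVertex j), ∀ v ∈ p.support, v ∈ C := by
  by_contra hcon
  -- The part of `C` reachable from `i` inside `C`. No edge joins it to the rest of `C`, so if it
  -- misses `j` the cut splits and gives an additive bipartition of `X`.
  let D : Finset V := C.filter fun v =>
    ∃ p : M.graph.Walk (M.boundaryVertex i) v, ∀ w ∈ p.support, w ∈ C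
  let Y : Finset (Party N) := Finset.univ.filter fun k => M.boundaryVertex k ∈ D
  have hDC : D ⊆ C := Finset.filter_subset _ _
  have hiD : M.boundaryVertex i ∈ D := by
    have := (hC.boundaryVertex_mem i).2 hi
    simp only [D, Finset.mem_filter]
    exact ⟨this, .nil, by simpa⟩
  have hYX : Y ⊆ X := fun k hk => by
    simp only [Y, Finset.mem_filter, Finset.mem_univ, true_and] at hk
    exact (hC.boundaryVertex_mem k).1 (hDC hk)
  have hjD : M.boundaryVertex j ∉ D := fun h => hcon (Finset.mem_filter.1 h).2
  have hcutD : M.IsCut Y D := hM.isCut_iff.2 fun k => by simp [Y]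
  have hcutCD : M.IsCut (X \ Y) (C \ D) := hM.isCut_iff.2 fun k => by
    simp [Y, hC.boundaryVertex_mem k]
  have hcostle := M.cost_add_cost_sdiff_le hDC fun u hu v hv huv => by
    simp only [D, Finset.mem_filter] at hu ⊢
    obtain ⟨-, p, hp⟩ := hu
    refine ⟨hv, p.concat huv, fun w hw => ?_⟩
    rw [SimpleGraph.Walk.support_concat] at hw
    simp only [List.mem_append, List.mem_singleton] at hw
    rcases hw with hw | rfl
    · exact hp w hw
    · exact hv
  have h1 := (hf _).le_cost hcutD
  have h2 := (hf _).le_cost hcutCD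
  obtain ⟨D₁, hD₁, e₁⟩ := (hf Y).1
  obtain ⟨D₂, hD₂, e₂⟩ := (hf (X \ Y)).1
  have hU : Y ∪ X \ Y = X := Finset.union_sdiff_of_subset hYX
  have hcutU : M.IsCut X (D₁ ∪ D₂) := hM.isCut_iff.2 fun k => by
    rw [← hU, Finset.mem_union, Finset.mem_union, hD₁.boundaryVertex_mem k,
      hD₂.boundaryVertex_mem k]
  have h3 := (hf _).le_cost hcutU
  have h4 := M.cost_union_le D₁ D₂
  refine hX.2 Y (X \ Y) ⟨i, by simpa [Y] using hiD⟩ ⟨j, by simp [Y, hj, hjD]⟩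
    Finset.disjoint_sdiff hU ?_
  linarith

open Classical in
/-- Disjoint sets of parties have disjoint minimum cuts. -/
theorem exists_disjoint_min_cuts (hM : M.IsSimple) {f : Finset (Party N) → ℝ}
    (hf : ∀ X, M.IsEntropy X (f X)) {X Y : Finset (Party N)} (hXY : Disjoint X Y) :
    ∃ C D : Finset V, M.IsCut X C ∧ M.IsCut Y D ∧ M.cost C ≤ f X ∧ M.cost D ≤ f Y ∧
      Disjoint C D := by
  obtain ⟨C, hC, eC⟩ := (hf X).1
  obtain ⟨D, hD, eD⟩ := (hf Y).1
  have hC' : M.IsCut X (C \ D) := hM.isCut_iff.2 fun k => by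
    rw [Finset.mem_sdiff, hC.boundaryVertex_mem k, hD.boundaryVertex_mem k]
    exact ⟨fun h => h.1, fun h => ⟨h, Finset.disjoint_left.1 hXY h⟩⟩
  have hD' : M.IsCut Y (D \ C) := hM.isCut_iff.2 fun k => by
    rw [Finset.mem_sdiff, hC.boundaryVertex_mem k, hD.boundaryVertex_mem k]
    exact ⟨fun h => h.1, fun h => ⟨h, Finset.disjoint_right.1 hXY h⟩⟩
  -- Uncrossing: the two differences together cost no more than the two minimum cuts, and each is at
  -- least as costly as the minimum, so both are minimal.
  have h := M.cost_sdiff_add_cost_sdiff_le C D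
  have h1 := (hf _).le_cost hC'
  have h2 := (hf _).le_cost hD'
  refine ⟨C \ D, D \ C, hC', hD', by linarith, by linarith, ?_⟩
  exact Finset.disjoint_left.2 (by simp; tauto)

end HolographicGraphModel

/-! ### Forest models are cross-free. -/

/-- In a forest, four vertices cannot be joined cyclically by walks such that opposite walks are
disjoint. -/
theorem SimpleGraph.IsAcyclic.false_of_disjoint_walks {V : Type*} {G : SimpleGraph V}
    (hG : G.IsAcyclic) {a b c d : V} (p : G.Walk a d) (q : G.Walk a b) (r : G.Walk c d)
    (s : G.Walk b c) (hps : ∀ v ∈ p.support, v ∉ s.support)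
    (hqr : ∀ v ∈ q.support, v ∉ r.support) : False := by
  classical
  -- The path from `a` to `d` has an edge leaving `q`. It cannot lie on `q`, nor on `s` or `r` by
  -- disjointness, so the detour through `b` and `c` avoids it, against uniqueness of paths in a
  -- forest.
  obtain ⟨e, he, h1, h2⟩ := p.bypass.exists_boundary_dart {v | v ∈ q.support}
    q.start_mem_support (fun h => hqr _ h r.end_mem_support)
  let t : G.Walk a d := q.append (s.append r)
  have hmem : e.edge ∈ p.bypass.edges := List.mem_map_of_mem he
  have ht : e.edge ∉ t.edges := by
    rw [SimpleGraph.Walk.edges_append, SimpleGraph.Walk.edges_append, List.mem_append,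
      List.mem_append]
    have hedge : e.edge = s(e.fst, e.snd) := rfl
    rw [hedge] at hmem ⊢
    rintro (h | h | h)
    · exact h2 (q.snd_mem_support_of_mem_edges h)
    · exact hps _ (p.support_bypass_subset_support (p.bypass.fst_mem_support_of_mem_edges hmem))
        (s.fst_mem_support_of_mem_edges h)
    · exact hqr _ h1 (r.fst_mem_support_of_mem_edges h)
  have h3 : p.bypass = t.bypass :=
    congrArg Subtype.val ((hG.subsingleton_path a d).elim p.toPath t.toPath)
  rw [h3] at hmem
  exact ht (t.edges_bypass_subset_edges hmem)

namespace HolographicGraphModel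

variable {N : ℕ} {V : Type*} [Fintype V] {M : HolographicGraphModel N V}

theorem IsSimpleForest.isCrossFree (hM : M.IsSimpleForest) {f : Finset (Party N) → ℝ}
    (hf : ∀ X, M.IsEntropy X (f X)) : IsCrossFree f := by
  rintro A B C D hA hB hC hD hAC hBD ⟨i, hi⟩ ⟨j, hj⟩ ⟨k, hk⟩ ⟨l, hl⟩
  rw [Finset.mem_inter] at hi hj hk hl
  obtain ⟨P, R, hP, hR, cP, cR, hPR⟩ := exists_disjoint_min_cuts hM.1 hf hAC
  obtain ⟨Q, T, hQ, hT, cQ, cT, hQT⟩ := exists_disjoint_min_cuts hM.1 hf hBD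
  obtain ⟨p, hp⟩ := exists_walk_in_min_cut hM.1 hf hA hP cP hi.1 hl.2
  obtain ⟨q, hq⟩ := exists_walk_in_min_cut hM.1 hf hB hQ cQ hi.2 hj.1
  obtain ⟨s, hs⟩ := exists_walk_in_min_cut hM.1 hf hC hR cR hj.2 hk.1
  obtain ⟨r, hr⟩ := exists_walk_in_min_cut hM.1 hf hD hT cT hk.2 hl.1
  exact hM.2.false_of_disjoint_walks p q r s
    (fun v h1 h2 => Finset.disjoint_left.1 hPR (hp v h1) (hs v h2))
    (fun v h1 h2 => Finset.disjoint_left.1 hQT (hq v h1) (hr v h2))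

end HolographicGraphModel

/-! ### From cross-freeness to chordality. -/

/-- The vertices of a walk in the line graph have a connected union. -/
theorem exists_connected_union_of_walk {N : ℕ} {S : EntropyVector N}
    (hf : IsSymmSubmodular S.ent) {x y : (correlationHypergraph S.pmi).edgeSet}
    (p : (hypergraphLineGraph (correlationHypergraph S.pmi)).Walk x y) :
    ∃ U : Finset (Party N), IsConnectedSet S.ent U ∧
      ∀ i, i ∈ U ↔ ∃ z ∈ p.support, i ∈ (z : Set (Party N)) := by
  induction p with
  | @nil x =>
    obtain ⟨X, -, hX, e⟩ := (EntropyVector.mem_edgeSet_iff _).1 x.2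
    exact ⟨X, hX, fun i => by simp [← e]⟩
  | @cons x y z h p ih =>
    obtain ⟨U, hU, hmem⟩ := ih
    obtain ⟨X, -, hX, e⟩ := (EntropyVector.mem_edgeSet_iff _).1 x.2
    refine ⟨X ∪ U, hf.isConnectedSet_union hX hU ?_, fun i => ?_⟩
    · obtain ⟨i, hi, hi'⟩ := h.2
      refine ⟨i, Finset.mem_inter.2 ⟨?_, (hmem i).2 ⟨y, p.start_mem_support, hi'⟩⟩⟩
      rwa [← e] at hi
    · rw [Finset.mem_union, hmem, SimpleGraph.Walk.support_cons]
      simp [← e]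

theorem isChordalGraph_of_isCrossFree {N : ℕ} {S : EntropyVector N}
    (hf : IsSymmSubmodular S.ent) (hS : IsCrossFree S.ent) :
    IsChordalGraph (hypergraphLineGraph (correlationHypergraph S.pmi)) := by
  intro x₀ c hc hlen
  by_contra hcon
  have hnup := hc.support_nodup
  match c, hc, hlen, hcon, hnup with
  | .cons (v := x₁) h₁ (.cons (v := x₂) h₂ (.cons (v := x₃) h₃ p)), hc, hlen, hcon, hnup =>
    simp only [SimpleGraph.Walk.support_cons, List.tail_cons, List.nodup_cons, List.mem_cons,
      not_or] at hnup
    obtain ⟨⟨n12, n1p⟩, n2p, hp⟩ := hnup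
    have hp0 := p.end_mem_support
    have hp3 := p.start_mem_support
    have hrev : p.reverse.support.Nodup := by simpa using hp
    have n30 : x₃ ≠ x₀ := by
      rintro rfl
      have : p = .nil :=
        SimpleGraph.Walk.eq_nil_iff_nil.2 (SimpleGraph.Walk.isPath_iff_nil.1 (.mk' hp))
      subst this
      simp at hlen
    -- The walk `q` runs through the cycle vertices other than `x₀`, `x₁`, `x₂`; the union of its
    -- hyperedges is the fourth set `D` of the forbidden pattern.
    obtain ⟨y, h₀, q, hq⟩ := SimpleGraph.Walk.exists_eq_cons_of_ne n30.symm p.reverse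
    rw [hq, SimpleGraph.Walk.support_cons, List.nodup_cons] at hrev
    have hqp : ∀ z ∈ q.support, z ∈ p.support := fun z hz => by
      have : z ∈ p.reverse.support := by rw [hq]; simp [hz]
      simpa using this
    have nonadj : ∀ a ∈ (SimpleGraph.Walk.cons h₁ (.cons h₂ (.cons h₃ p))).support,
        ∀ b ∈ (SimpleGraph.Walk.cons h₁ (.cons h₂ (.cons h₃ p))).support, a ≠ b →
        s(a, b) ∉ (SimpleGraph.Walk.cons h₁ (.cons h₂ (.cons h₃ p))).edges →
        Disjoint (a : Set (Party N)) b := by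
      intro a ha b hb hab he
      rw [Set.disjoint_iff_inter_eq_empty, ← Set.not_nonempty_iff_eq_empty]
      exact fun hne => hcon ⟨a, ha, b, hb, ⟨hab, hne⟩, he⟩
    have ne1 : ∀ z ∈ p.support, x₁ ≠ z := fun z hz e => n1p (e ▸ hz)
    have ne2 : ∀ z ∈ p.support, x₂ ≠ z := fun z hz e => n2p (e ▸ hz)
    have d02 : Disjoint (x₀ : Set (Party N)) x₂ := by
      refine nonadj _ (by simp) _ (by simp) (ne2 _ hp0).symm ?_
      simp only [SimpleGraph.Walk.edges_cons, List.mem_cons, Sym2.eq_iff]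
      rintro ((⟨-, h⟩ | ⟨h, -⟩) | (⟨h, -⟩ | ⟨h, -⟩) | (⟨h, -⟩ | ⟨h, -⟩) | h)
      · exact n12 h.symm
      · exact ne1 _ hp0 h.symm
      · exact ne1 _ hp0 h.symm
      · exact ne2 _ hp0 h.symm
      · exact ne2 _ hp0 h.symm
      · exact n30 h.symm
      · exact n2p (p.snd_mem_support_of_mem_edges h)
    have d1 : ∀ z ∈ q.support, Disjoint (x₁ : Set (Party N)) z := by
      intro z hz
      have hz0 : z ≠ x₀ := fun e => hrev.1 (e ▸ hz)
      have hzp := hqp z hz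
      refine nonadj _ (by simp) _ (by simp [hzp]) (ne1 _ hzp) ?_
      simp only [SimpleGraph.Walk.edges_cons, List.mem_cons, Sym2.eq_iff]
      rintro ((⟨h, -⟩ | ⟨-, h⟩) | (⟨-, h⟩ | ⟨h, -⟩) | (⟨h, -⟩ | ⟨h, -⟩) | h)
      · exact ne1 _ hp0 h
      · exact hz0 h
      · exact ne2 _ hzp h.symm
      · exact n12 h
      · exact n12 h
      · exact ne1 _ hp3 h
      · exact n1p (p.fst_mem_support_of_mem_edges h)
    obtain ⟨D, hD, hDmem⟩ := exists_connected_union_of_walk hf q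
    obtain ⟨A, -, hA, eA⟩ := (EntropyVector.mem_edgeSet_iff _).1 x₀.2
    obtain ⟨B, -, hB, eB⟩ := (EntropyVector.mem_edgeSet_iff _).1 x₁.2
    obtain ⟨C, -, hC, eC⟩ := (EntropyVector.mem_edgeSet_iff _).1 x₂.2
    refine hS A B C D hA hB hC hD ?_ ?_ ?_ ?_ ?_ ?_
    · rwa [← eA, ← eC, Finset.disjoint_coe] at d02
    · rw [Finset.disjoint_left]
      intro i hi hi'
      obtain ⟨z, hz, hiz⟩ := (hDmem i).1 hi'
      refine Set.disjoint_left.1 (d1 z hz) ?_ hiz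
      rwa [← eB]
    · have := h₁.2
      rw [← eA, ← eB] at this
      exact_mod_cast this
    · have := h₂.2
      rw [← eB, ← eC] at this
      exact_mod_cast this
    · obtain ⟨i, hi, hi'⟩ := h₃.2
      rw [← eC] at hi
      exact ⟨i, Finset.mem_inter.2 ⟨hi, (hDmem i).2 ⟨_, q.end_mem_support, hi'⟩⟩⟩
    · obtain ⟨i, hi, hi'⟩ := h₀.2
      rw [← eA] at hi
      exact ⟨i, Finset.mem_inter.2 ⟨(hDmem i).2 ⟨_, q.start_mem_support, hi'⟩, hi⟩⟩

/-! ### Laminar families and their trees. -/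

/-- A family of sets is laminar if any two members are nested or disjoint. -/
def IsLaminar {α : Type*} (L : Set (Finset α)) : Prop :=
  ∀ X ∈ L, ∀ Y ∈ L, X ⊆ Y ∨ Y ⊆ X ∨ Disjoint X Y

/-- A laminar family of non-empty sets that contains the set of all parties and all singletons. -/
structure IsPartyHierarchy {N : ℕ} (L : Set (Finset (Party N))) : Prop where
  laminar : IsLaminar L
  nonempty : ∀ X ∈ L, X.Nonempty
  univ_mem : Finset.univ ∈ L
  singleton_mem : ∀ i, {i} ∈ L

namespace IsPartyHierarchy

variable {N : ℕ} {L : Set (Finset (Party N))}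

theorem exists_parent (hL : IsPartyHierarchy L) {X : Finset (Party N)} (hX : X ∈ L)
    (hne : X ≠ Finset.univ) : ∃ P ∈ L, X ⊂ P ∧ ∀ Y ∈ L, X ⊂ Y → P ⊆ Y := by
  classical
  obtain ⟨P, hP, hmin⟩ := (Finset.univ.filter fun Y => Y ∈ L ∧ X ⊂ Y).exists_min_image
    Finset.card ⟨Finset.univ, by simp [hL.univ_mem, Finset.ssubset_univ_iff, hne]⟩
  simp only [Finset.mem_filter, Finset.mem_univ, true_and, and_imp] at hP hmin
  refine ⟨P, hP.1, hP.2, fun Y hY hXY => ?_⟩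
  rcases hL.laminar P hP.1 Y hY with h | h | h
  · exact h
  · exact (Finset.eq_of_subset_of_card_le h (hmin Y hY hXY)).ge
  · obtain ⟨x, hx⟩ := hL.nonempty X hX
    exact absurd (hXY.1 hx) (Finset.disjoint_left.1 h (hP.2.1 hx))

open Classical in
/-- The smallest member of the family that strictly contains a given one. -/
noncomputable def parent (hL : IsPartyHierarchy L) (X : Finset (Party N)) : Finset (Party N) :=
  if h : X ∈ L ∧ X ≠ Finset.univ then (hL.exists_parent h.1 h.2).choose else Finset.univ

variable (hL : IsPartyHierarchy L) {X Y : Finset (Party N)}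
include hL

theorem parent_spec (hX : X ∈ L) (hne : X ≠ Finset.univ) :
    hL.parent X ∈ L ∧ X ⊂ hL.parent X ∧ ∀ Y ∈ L, X ⊂ Y → hL.parent X ⊆ Y := by
  rw [parent, dif_pos ⟨hX, hne⟩]
  exact (hL.exists_parent hX hne).choose_spec

theorem subset_of_parent_subset (hX : X ∈ L) (hne : X ≠ Finset.univ)
    (h : hL.parent X ⊆ Y) : X ⊆ Y :=
  (hL.parent_spec hX hne).2.1.1.trans h

theorem parent_subset (hX : X ∈ L) (hne : X ≠ Finset.univ) (hY : Y ∈ L) (hXY : X ⊆ Y)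
    (hXY' : X ≠ Y) : hL.parent X ⊆ Y :=
  (hL.parent_spec hX hne).2.2 Y hY (Finset.ssubset_iff_subset_ne.2 ⟨hXY, hXY'⟩)

/-- The tree of a hierarchy: every member is joined to its parent by an edge whose weight is its
value. -/
noncomputable def model {f : Finset (Party N) → ℝ} (hf : ∀ X, 0 ≤ f X) :
    HolographicGraphModel N (Finset (Party N)) where
  graph :=
    { Adj := fun X Y => (X ∈ L ∧ X ≠ Finset.univ ∧ hL.parent X = Y) ∨
        (Y ∈ L ∧ Y ≠ Finset.univ ∧ hL.parent Y = X)
      symm := ⟨fun _ _ h => h.symm⟩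
      loopless := ⟨fun X h => by
        rcases h with ⟨h1, h2, h3⟩ | ⟨h1, h2, h3⟩ <;>
          exact (hL.parent_spec h1 h2).2.1.ne h3.symm⟩ }
  -- The intersection is symmetric in the endpoints and, on an edge from a member to its parent,
  -- equals that member.
  weight := Sym2.lift ⟨fun X Y => f (X ∩ Y), fun X Y => congrArg f (Finset.inter_comm X Y)⟩
  weight_nonneg e _ := by
    induction e with | _ X Y
    exact hf _
  boundary := Set.range fun i : Party N => ({i} : Finset (Party N))
  label := (Equiv.ofInjective (fun i : Party N => ({i} : Finset (Party N)))
    Finset.singleton_injective).symm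
  label_surjective := Equiv.surjective _

variable {f : Finset (Party N) → ℝ} (hf : ∀ X, 0 ≤ f X)

theorem model_adj : (hL.model hf).graph.Adj X Y ↔ (X ∈ L ∧ X ≠ Finset.univ ∧ hL.parent X = Y) ∨
    (Y ∈ L ∧ Y ≠ Finset.univ ∧ hL.parent Y = X) := Iff.rfl

theorem model_isCut_iff {C : Finset (Finset (Party N))} :
    (hL.model hf).IsCut X C ↔ ∀ i, {i} ∈ C ↔ i ∈ X := by
  have hlabel : ∀ i, (hL.model hf).label ⟨{i}, i, rfl⟩ = i := fun i =>
    Equiv.ofInjective_symm_apply Finset.singleton_injective i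
  constructor
  · intro h i
    have := h ⟨{i}, i, rfl⟩
    rwa [hlabel] at this
  · rintro h ⟨_, i, rfl⟩
    rw [hlabel]
    exact h i

theorem model_isSimpleForest : (hL.model hf).IsSimpleForest := by
  refine ⟨Equiv.injective _, SimpleGraph.isAcyclic_iff_forall_adj_isBridge.2 ?_⟩
  have key : ∀ X, X ∈ L → X ≠ Finset.univ →
      (hL.model hf).graph.IsBridge s(X, hL.parent X) := by
    intro X hX hne
    rw [SimpleGraph.isBridge_iff]
    rintro ⟨p⟩
    -- The edge from `X` to its parent is the only one that leaves the collection of subsets of `X`.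
    obtain ⟨e, -, h1, h2⟩ := p.exists_boundary_dart {Y | Y ⊆ X} (Finset.Subset.refl X)
      (fun h => (hL.parent_spec hX hne).2.1.2 h)
    have hadj := e.adj
    rw [SimpleGraph.deleteEdges_adj, model_adj] at hadj
    obtain ⟨⟨a1, a2, a3⟩ | ⟨a1, a2, a3⟩, hed⟩ := hadj
    · by_cases heq : e.fst = X
      · exact hed (by rw [← a3, heq]; rfl)
      · exact h2 (a3 ▸ hL.parent_subset a1 a2 hX h1 heq)
    · exact h2 (hL.subset_of_parent_subset a1 a2 (a3 ▸ h1))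
  intro X Y hadj
  rcases (hL.model_adj hf).1 hadj with ⟨h1, h2, rfl⟩ | ⟨h1, h2, rfl⟩
  · exact key X h1 h2
  · rw [Sym2.eq_swap]
    exact key Y h1 h2

open Classical in
theorem model_cost (C : Finset (Finset (Party N))) :
    (hL.model hf).cost C = ∑ Y : Finset (Party N) with
      Y ∈ L ∧ Y ≠ Finset.univ ∧ ¬ (Y ∈ C ↔ hL.parent Y ∈ C), f Y := by
  have himage : (hL.model hf).cutEdges C = (Finset.univ.filter fun Y : Finset (Party N) =>
      Y ∈ L ∧ Y ≠ Finset.univ ∧ ¬ (Y ∈ C ↔ hL.parent Y ∈ C)).image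
        fun Y => s(Y, hL.parent Y) := by
    ext e
    induction e with | _ X Y
    rw [HolographicGraphModel.mem_cutEdges_iff, model_adj]
    simp only [Finset.mem_image, Finset.mem_filter, Finset.mem_univ, true_and]
    constructor
    · rintro ⟨⟨h1, h2, rfl⟩ | ⟨h1, h2, rfl⟩, h3⟩
      · exact ⟨X, ⟨h1, h2, h3⟩, rfl⟩
      · exact ⟨Y, ⟨h1, h2, by tauto⟩, Sym2.eq_swap⟩
    · rintro ⟨Z, ⟨h1, h2, h3⟩, he⟩
      rcases Sym2.eq_iff.1 he with ⟨rfl, rfl⟩ | ⟨rfl, rfl⟩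
      · exact ⟨Or.inl ⟨h1, h2, rfl⟩, h3⟩
      · exact ⟨Or.inr ⟨h1, h2, rfl⟩, by tauto⟩
  rw [HolographicGraphModel.cost, himage, Finset.sum_image]
  · refine Finset.sum_congr rfl fun Y hY => ?_
    simp only [Finset.mem_filter, Finset.mem_univ, true_and] at hY
    change f (Y ∩ hL.parent Y) = f Y
    rw [Finset.inter_eq_left.2 (hL.parent_spec hY.1 hY.2.1).2.1.1]
  · intro Y hY Z hZ he
    simp only [Finset.coe_filter, Finset.mem_univ, true_and, Set.mem_ofPred_eq] at hY hZ
    rcases Sym2.eq_iff.1 he with ⟨h, -⟩ | ⟨h1, h2⟩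
    · exact h
    · have hY' := (hL.parent_spec hY.1 hY.2.1).2.1
      have hZ' := (hL.parent_spec hZ.1 hZ.2.1).2.1
      rw [h2] at hY'
      rw [← h1] at hZ'
      exact absurd hZ'.1 hY'.2

open Classical in
/-- The descendants of a member of the hierarchy form a cut whose cost is its value. -/
theorem exists_cut_of_mem (hX : X ∈ L) :
    ∃ C, (hL.model hf).IsCut X C ∧ (hL.model hf).cost C ≤ f X := by
  refine ⟨Finset.univ.filter fun Y => Y ⊆ X, (hL.model_isCut_iff hf).2 fun i => by simp, ?_⟩
  rw [model_cost, ← Finset.sum_singleton f X]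
  refine Finset.sum_le_sum_of_subset_of_nonneg (fun Y hY => ?_) fun _ _ _ => hf _
  simp only [Finset.mem_filter, Finset.mem_univ, true_and] at hY
  obtain ⟨h1, h2, h3⟩ := hY
  rw [Finset.mem_singleton]
  by_contra hne
  exact h3 ⟨fun h => hL.parent_subset h1 h2 hX h hne, hL.subset_of_parent_subset h1 h2⟩

omit hf in
open Classical in
/-- Every cut of the tree costs at least the value of the corresponding set of parties. -/
theorem le_model_cost (hf : IsSymmSubmodular f) {C : Finset (Finset (Party N))}
    (hC : (hL.model hf.nonneg).IsCut X C) : f X ≤ (hL.model hf.nonneg).cost C := by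
  rw [model_cost]
  set T : Finset (Finset (Party N)) := Finset.univ.filter fun Y =>
    Y ∈ L ∧ Y ≠ Finset.univ ∧ ¬ (Y ∈ C ↔ hL.parent Y ∈ C) with hT
  -- Ascending from `Y` to the root, the side of the cut changes once for each cut edge on the way,
  -- and those edges correspond to the members of `T` that contain `Y`. The induction passes from
  -- `Y` to its parent.
  have key : ∀ n, ∀ Y ∈ L, Yᶜ.card = n →
      (¬ (Y ∈ C ↔ Finset.univ ∈ C) ↔ Odd (T.filter fun Z => Y ⊆ Z).card) := by
    intro n
    induction n using Nat.strong_induction_on with | _ n ih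
    rintro Y hY rfl
    by_cases hne : Y = Finset.univ
    · subst hne
      have : T.filter (fun Z => Finset.univ ⊆ Z) = ∅ := by
        ext Z
        simp only [hT, Finset.mem_filter, Finset.univ_subset_iff]
        simp +contextual
      rw [this]
      simp
    · obtain ⟨hP, hYP, -⟩ := hL.parent_spec hY hne
      have := ih _ (Finset.card_lt_card (Finset.compl_ssubset_compl.2 hYP)) _ hP rfl
      have hsplit : ∀ Z ∈ T, Y ⊆ Z ↔ Z = Y ∨ hL.parent Y ⊆ Z := by
        intro Z hZ
        simp only [hT, Finset.mem_filter, Finset.mem_univ, true_and] at hZ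
        constructor
        · intro h
          by_cases heq : Y = Z
          · exact Or.inl heq.symm
          · exact Or.inr (hL.parent_subset hY hne hZ.1 h heq)
        · rintro (rfl | h)
          · exact Finset.Subset.refl _
          · exact hL.subset_of_parent_subset hY hne h
      rw [Finset.filter_congr hsplit]
      by_cases hYT : Y ∈ T
      · have hins : T.filter (fun Z => Z = Y ∨ hL.parent Y ⊆ Z) =
            insert Y (T.filter fun Z => hL.parent Y ⊆ Z) := by
          ext Z
          simp only [Finset.mem_filter, Finset.mem_insert]
          constructor
          · rintro ⟨h1, h2 | h2⟩ <;> tauto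
          · rintro (rfl | h) <;> tauto
        have hnot : Y ∉ T.filter fun Z => hL.parent Y ⊆ Z := by
          simp [hYP.2]
        rw [hins, Finset.card_insert_of_notMem hnot, Nat.odd_add_one, ← this]
        simp only [hT, Finset.mem_filter] at hYT
        tauto
      · have hsame : T.filter (fun Z => Z = Y ∨ hL.parent Y ⊆ Z) =
            T.filter fun Z => hL.parent Y ⊆ Z := by
          refine Finset.filter_congr fun Z hZ => ?_
          have : Z ≠ Y := fun h => hYT (h ▸ hZ)
          tauto
        rw [hsame, ← this]
        simp only [hT, Finset.mem_filter, Finset.mem_univ, true_and] at hYT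
        tauto
  have hcover : (Finset.univ.filter fun i : Party N => Odd (T.filter fun Y => i ∈ Y).card) =
      Finset.univ.filter fun i : Party N => ¬ (i ∈ X ↔ Finset.univ ∈ C) := by
    refine Finset.filter_congr fun i _ => ?_
    have := key _ {i} (hL.singleton_mem i) rfl
    simp only [Finset.singleton_subset_iff] at this
    rw [← this, ((hL.model_isCut_iff hf.nonneg).1 hC i)]
  have hle := hf.odd_cover_le T
  rw [hcover] at hle
  -- The oddly covered parties are those separated from the root of the tree: `Xᶜ` or `X`, which
  -- have equal value.
  by_cases htop : Finset.univ ∈ C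
  · have : (Finset.univ.filter fun i : Party N => ¬ (i ∈ X ↔ Finset.univ ∈ C)) = Xᶜ := by
      ext i
      simp [htop]
    rwa [this, hf.compl] at hle
  · have : (Finset.univ.filter fun i : Party N => ¬ (i ∈ X ↔ Finset.univ ∈ C)) = X := by
      ext i
      simp [htop]
    rwa [this] at hle

end IsPartyHierarchy

/-! ### The hierarchy of connected sets. -/

/-- A chosen element of a non-empty set of parties. -/
noncomputable def rootParty {N : ℕ} (K : Finset (Party N)) : Party N :=
  open Classical in if h : K.Nonempty then h.choose else 0

theorem rootParty_mem {N : ℕ} {K : Finset (Party N)} (h : K.Nonempty) : rootParty K ∈ K := by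
  rw [rootParty, dif_pos h]
  exact h.choose_spec

/-- All parties, the single parties, the connected components, and the rootless halves of the
bipartitions of a component into two connected sets. -/
def connectedHierarchy {N : ℕ} (f : Finset (Party N) → ℝ) : Set (Finset (Party N)) :=
  {X | X = Finset.univ ∨ (∃ i, X = {i}) ∨ (f X = 0 ∧ IsConnectedSet f X) ∨
    (IsConnectedSet f X ∧ ∃ Y, IsConnectedSet f Y ∧ Disjoint X Y ∧ f (X ∪ Y) = 0 ∧
      IsConnectedSet f (X ∪ Y) ∧ rootParty (X ∪ Y) ∈ Y)}

theorem Finset.nested_or_disjoint_of_inter {α : Type*} [DecidableEq α] {X Y : Finset α}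
    (h : (X ∩ Y).Nonempty → X ⊆ Y ∨ Y ⊆ X) : X ⊆ Y ∨ Y ⊆ X ∨ Disjoint X Y := by
  rw [Finset.disjoint_iff_inter_eq_empty, ← Finset.not_nonempty_iff_eq_empty]
  tauto

theorem isPartyHierarchy_connectedHierarchy {N : ℕ} {f : Finset (Party N) → ℝ}
    (hf : IsSymmSubmodular f) (hfree : IsCrossFree f) :
    IsPartyHierarchy (connectedHierarchy f) where
  univ_mem := Or.inl rfl
  singleton_mem i := Or.inr (Or.inl ⟨i, rfl⟩)
  nonempty X hX := by
    rcases hX with rfl | ⟨i, rfl⟩ | ⟨-, h⟩ | ⟨h, -⟩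
    · exact Finset.univ_nonempty
    · exact Finset.singleton_nonempty i
    · exact h.1
    · exact h.1
  laminar := by
    have hconn : ∀ X ∈ connectedHierarchy f,
        X = Finset.univ ∨ (∃ i, X = {i}) ∨ IsConnectedSet f X := by
      rintro X (h | h | ⟨-, h⟩ | ⟨h, -⟩) <;> tauto
    intro X hX Y hY
    apply Finset.nested_or_disjoint_of_inter
    intro hXY
    have hYX : (Y ∩ X).Nonempty := by rwa [Finset.inter_comm]
    obtain ⟨x, hx⟩ := hXY
    obtain ⟨hxX, hxY⟩ := Finset.mem_inter.1 hx
    rcases hconn X hX with rfl | ⟨i, rfl⟩ | hcX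
    · exact Or.inr (Finset.subset_univ _)
    · rw [Finset.mem_singleton] at hxX
      exact Or.inl (Finset.singleton_subset_iff.2 (hxX ▸ hxY))
    rcases hconn Y hY with rfl | ⟨i, rfl⟩ | hcY
    · exact Or.inl (Finset.subset_univ _)
    · rw [Finset.mem_singleton] at hxY
      exact Or.inr (Finset.singleton_subset_iff.2 (hxY ▸ hxX))
    rcases hX with rfl | ⟨i, rfl⟩ | ⟨h0, -⟩ | ⟨-, X', hX', hdX, h0X, hKX, hrX⟩
    · exact Or.inr (Finset.subset_univ _)
    · rw [Finset.mem_singleton] at hxX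
      exact Or.inl (Finset.singleton_subset_iff.2 (hxX ▸ hxY))
    · exact Or.inr (hf.subset_of_eq_zero hcY h0 hYX)
    rcases hY with rfl | ⟨i, rfl⟩ | ⟨h0, -⟩ | ⟨-, Y', hY', hdY, h0Y, hKY, hrY⟩
    · exact Or.inl (Finset.subset_univ _)
    · rw [Finset.mem_singleton] at hxY
      exact Or.inr (Finset.singleton_subset_iff.2 (hxY ▸ hxX))
    · exact Or.inl (hf.subset_of_eq_zero hcX h0 ⟨x, hx⟩)
    have hK : X ∪ X' = Y ∪ Y' := by
      apply Finset.Subset.antisymm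
      · exact hf.subset_of_eq_zero hKX h0Y ⟨x, by simp [hxX, hxY]⟩
      · exact hf.subset_of_eq_zero hKY h0X ⟨x, by simp [hxX, hxY]⟩
    by_contra! hcon
    obtain ⟨h1, h2⟩ := hcon
    obtain ⟨a, haX, haY⟩ := Finset.not_subset.1 h1
    obtain ⟨b, hbY, hbX⟩ := Finset.not_subset.1 h2
    have haY' : a ∈ Y' := by
      have : a ∈ Y ∪ Y' := hK ▸ Finset.mem_union_left _ haX
      exact (Finset.mem_union.1 this).resolve_left haY
    have hbX' : b ∈ X' := by
      have : b ∈ X ∪ X' := hK ▸ Finset.mem_union_left _ hbY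
      exact (Finset.mem_union.1 this).resolve_left hbX
    rw [hK] at hrX
    -- Both halves omit the root of their common component, so the root witnesses that `X'` meets
    -- `Y'`; this is what excludes a pair that overlaps and covers the component.
    exact hfree X Y X' Y' hcX hcY hX' hY' hdX hdY ⟨x, hx⟩ ⟨b, Finset.mem_inter.2 ⟨hbY, hbX'⟩⟩
      ⟨_, Finset.mem_inter.2 ⟨hrX, hrY⟩⟩ ⟨a, Finset.mem_inter.2 ⟨haY', haX⟩⟩

/-! ### Cuts attaining the entropies. -/

namespace IsPartyHierarchy

variable {N : ℕ} {L : Set (Finset (Party N))} {f : Finset (Party N) → ℝ}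

theorem exists_cut_union (hL : IsPartyHierarchy L) (hf : ∀ X, 0 ≤ f X) {X Y : Finset (Party N)}
    (hX : ∃ C, (hL.model hf).IsCut X C ∧ (hL.model hf).cost C ≤ f X)
    (hY : ∃ C, (hL.model hf).IsCut Y C ∧ (hL.model hf).cost C ≤ f Y) :
    ∃ C, (hL.model hf).IsCut (X ∪ Y) C ∧ (hL.model hf).cost C ≤ f X + f Y := by
  obtain ⟨C, hC, hC'⟩ := hX
  obtain ⟨D, hD, hD'⟩ := hY
  rw [model_isCut_iff] at hC hD
  refine ⟨C ∪ D, (hL.model_isCut_iff hf).2 fun i => ?_, ?_⟩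
  · rw [Finset.mem_union, Finset.mem_union, hC, hD]
  · linarith [(hL.model hf).cost_union_le C D]

theorem exists_cut_sdiff (hL : IsPartyHierarchy L) (hf : ∀ X, 0 ≤ f X) {X Y : Finset (Party N)}
    (hX : ∃ C, (hL.model hf).IsCut X C ∧ (hL.model hf).cost C ≤ f X)
    (hY : ∃ C, (hL.model hf).IsCut Y C ∧ (hL.model hf).cost C ≤ f Y) :
    ∃ C, (hL.model hf).IsCut (X \ Y) C ∧ (hL.model hf).cost C ≤ f X + f Y := by
  obtain ⟨C, hC, hC'⟩ := hX
  obtain ⟨D, hD, hD'⟩ := hY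
  rw [model_isCut_iff] at hC hD
  refine ⟨C \ D, (hL.model_isCut_iff hf).2 fun i => ?_, ?_⟩
  · rw [Finset.mem_sdiff, Finset.mem_sdiff, hC, hD]
  · linarith [(hL.model hf).cost_sdiff_add_cost_sdiff_le C D, (hL.model hf).cost_nonneg (D \ C)]

/-- Every set of parties has a cut in the tree of the connected hierarchy that costs at most its
value. -/
theorem exists_cut (hL : IsPartyHierarchy (connectedHierarchy f)) (hf : IsSymmSubmodular f)
    (X : Finset (Party N)) :
    ∃ C, (hL.model hf.nonneg).IsCut X C ∧ (hL.model hf.nonneg).cost C ≤ f X := by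
  classical
  set P : Finset (Party N) → Prop := fun X =>
    ∃ C, (hL.model hf.nonneg).IsCut X C ∧ (hL.model hf.nonneg).cost C ≤ f X
  have hmem : ∀ X ∈ connectedHierarchy f, P X := fun X hX => hL.exists_cut_of_mem hf.nonneg hX
  change P X
  by_contra hX
  -- Minimality is by value first and cardinality second: cardinality handles splittings of `X`,
  -- value those of `K \ X`, whose parts may be larger than `X`.
  obtain ⟨X, hX, hmin⟩ := (Finset.univ.filter fun X => ¬ P X).exists_min_image
    (fun X => toLex (f X, X.card)) ⟨X, by simp [hX]⟩
  simp only [Finset.mem_filter, Finset.mem_univ, true_and, Prod.Lex.le_iff] at hX hmin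
  have hsmall : ∀ Y, f Y < f X ∨ f Y ≤ f X ∧ Y.card < X.card → P Y := by
    intro Y hY
    by_contra h
    rcases hmin Y h with h1 | ⟨h1, h2⟩
    · change f X < f Y at h1
      rcases hY with h | h <;> linarith [h]
    · change f X = f Y at h1
      change X.card ≤ Y.card at h2
      rcases hY with h | h
      · linarith
      · omega
  have hsplit : ∀ Y Z, P Y → P Z → f Y + f Z = f (Y ∪ Z) → P (Y ∪ Z) := by
    intro Y Z hY hZ h
    have := hL.exists_cut_union hf.nonneg hY hZ
    rwa [h] at this
  have hne : X.Nonempty := by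
    rw [Finset.nonempty_iff_ne_empty]
    rintro rfl
    refine hX ⟨∅, (hL.model_isCut_iff hf.nonneg).2 fun i => by simp, ?_⟩
    rw [HolographicGraphModel.cost_empty, hf.empty]
  have hconn : IsConnectedSet f X := by
    refine ⟨hne, ?_⟩
    rintro Y Z hY hZ hYZ rfl h
    have hcard := Finset.card_union_of_disjoint hYZ
    have := hY.card_pos
    have := hZ.card_pos
    have := hf.nonneg Y
    have := hf.nonneg Z
    exact hX (hsplit Y Z (hsmall Y (Or.inr ⟨by linarith, by omega⟩))
      (hsmall Z (Or.inr ⟨by linarith, by omega⟩)) h)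
  obtain ⟨K, hK, hcK, hXK⟩ := hf.exists_component hconn
  have hPK : P K := hmem K (Or.inr (Or.inr (Or.inl ⟨hK, hcK⟩)))
  have hXne : X ≠ K := fun h => hX (h ▸ hPK)
  have hcompl := hf.sdiff_eq hK hXK
  -- Since `K` has a cut of cost zero, removing a cut of `K \ X` from it gives a cut of `X` at no
  -- extra cost.
  have hback : ¬ P (K \ X) := by
    intro h
    have := hL.exists_cut_sdiff hf.nonneg hPK h
    rw [Finset.sdiff_sdiff_eq_self hXK, hK, zero_add, hcompl] at this
    exact hX this
  have hne' : (K \ X).Nonempty :=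
    Finset.sdiff_nonempty.2 fun h => hXne (Finset.Subset.antisymm hXK h)
  have hU : X ∪ K \ X = K := Finset.union_sdiff_of_subset hXK
  have hU' : K \ X ∪ X = K := Finset.sdiff_union_of_subset hXK
  have hpos : ∀ Y, Y.Nonempty → Y ⊆ K \ X → 0 < f Y := by
    intro Y hY hYK
    refine lt_of_le_of_ne (hf.nonneg Y) fun h0 => ?_
    obtain ⟨y, hy⟩ := hY
    have hKY := hf.subset_of_eq_zero hcK h0.symm
      ⟨y, Finset.mem_inter.2 ⟨(Finset.mem_sdiff.1 (hYK hy)).1, hy⟩⟩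
    obtain ⟨x, hx⟩ := hne
    exact (Finset.mem_sdiff.1 (hYK (hKY (hXK hx)))).2 hx
  by_cases hconn' : IsConnectedSet f (K \ X)
  · have hroot := rootParty_mem hcK.1
    -- Whichever half misses the root is a member of the hierarchy and so has a cheap cut.
    by_cases hr : rootParty K ∈ X
    · exact hback (hmem _ (Or.inr (Or.inr (Or.inr ⟨hconn', X, hconn, Finset.sdiff_disjoint,
        by rwa [hU'], by rwa [hU'], by rwa [hU']⟩))))
    · exact hX (hmem _ (Or.inr (Or.inr (Or.inr ⟨hconn, K \ X, hconn', Finset.disjoint_sdiff,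
        by rwa [hU], by rwa [hU], by rw [hU]; exact Finset.mem_sdiff.2 ⟨hroot, hr⟩⟩))))
  · simp only [IsConnectedSet, hne', true_and, not_forall, not_not] at hconn'
    obtain ⟨Y, Z, hY, hZ, hYZ, hYZU, h⟩ := hconn'
    -- The two values are positive and add up to `f (K \ X) = f X`, so each is strictly below `f X`.
    have hY0 := hpos Y hY (hYZU ▸ Finset.subset_union_left)
    have hZ0 := hpos Z hZ (hYZU ▸ Finset.subset_union_right)
    refine hback (hYZU ▸ hsplit Y Z (hsmall Y (Or.inl ?_)) (hsmall Z (Or.inl ?_)) ?_)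
    · linarith
    · linarith
    · rw [h, hYZU]

end IsPartyHierarchy

theorem exists_simpleForest_of_isCrossFree {N : ℕ} {S : EntropyVector N}
    (hf : IsSymmSubmodular S.ent) (hfree : IsCrossFree S.ent) :
    ∃ (V : Type) (_ : Fintype V) (M : HolographicGraphModel N V),
      M.IsSimpleForest ∧ M.Realizes S := by
  have hL := isPartyHierarchy_connectedHierarchy hf hfree
  refine ⟨Finset (Party N), inferInstance, hL.model hf.nonneg, hL.model_isSimpleForest hf.nonneg,
    fun X => ?_⟩
  have hX : S.ent X = S X := by
    rw [EntropyVector.ent, dif_pos X.2]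
  rw [← hX]
  obtain ⟨C, hC, hcost⟩ := hL.exists_cut hf (X : Finset (Party N))
  refine ⟨⟨C, hC, le_antisymm (hL.le_model_cost hf hC) hcost⟩, ?_⟩
  rintro _ ⟨D, hD, rfl⟩
  exact hL.le_model_cost hf hD

theorem theorem1 (N : ℕ) (S : EntropyVector N) (hSA : S.SA) (hSSA : S.SSA) :
    (∃ (V : Type) (_ : Fintype V) (M : HolographicGraphModel N V),
        M.IsSimpleForest ∧ M.Realizes S) ↔
      IsChordalGraph (hypergraphLineGraph (correlationHypergraph S.pmi)) := by
  have hf := EntropyVector.isSymmSubmodular hSA hSSA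
  constructor
  · rintro ⟨V, _, M, hM, hS⟩
    exact isChordalGraph_of_isCrossFree hf (hM.isCrossFree hS.isEntropy_ent)
  · exact fun h => exists_simpleForest_of_isCrossFree hf (isCrossFree_of_isChordalGraph h)
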